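/- Let $M_0,M\ge 1$ be integers and let $T$ be a matrix indexed by $\mathbb S=(\{0\}\times\{1,\dots,M_0\})\cup(\mathbb N\times\{1,\dots,M\})$ (with $\mathbb N=\{1,2,\dots\}$; the first coordinate is called the level) whose blocks are as follows: from level $k\ge 1$ to level $l\ge 1$ it is the $M\times M$ matrix $A(l-k)$; from level $0$ to level $0$ it is the $M_0\times M_0$ matrix $B(0)$; from level $0$ to level $l\ge1$ it is the $M_0\times M$ matrix $B(l)$; from level $k\ge1$ to level $0$ it is the $M\times M_0$ matrix $B(-k)$. Assume that $T$ is an irreducible, positive recurrent stochastic matrix with stationary distribution $x=(x(0),x(1),x(2),\dots)$ (partitioned by levels, row vectors), and put $\overline x(0)=\sum_{l\ge1}x(l)$. Assume that $A=\sum_{k\in\mathbb Z}A(k)$ is irreducible and strictly substochastic, i.e. $Ae\le e$ and $Ae\ne e$, where $e$ is the column vector of ones. Let $Y$ be a random variable in $\{0,1,2,\dots\}$ such that $$\lim_{k\to\infty}\frac{A(k)}{P(Y=k)}=C_A,\qquad \lim_{k\to\infty}\frac{B(k)}{P(Y=k)}=C_B$$ with (nonnegative, finite) matrices $C_A$ ($M\times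 M$) and $C_B$ ($M_0\times M$) that are not both zero. Assume that $Y$ is locally subexponential with span one, i.e. $P(Y=k)>0$ for all large $k$, $P(Y=k+1)/P(Y=k)\to1$ and $P(Y_1+Y_2=k)/P(Y=k)\to 2$ as $k\to\infty$, where $Y_1,Y_2$ are independent copies of $Y$. Assume finally that the convergence radius $r_{A_-}$ of $\sum_{k\ge1}z^kA(-k)$ satisfies $r_{A_-}>1$, or that the sequence $P(Y=k)$ is nonincreasing from some $k$ on. Then $I-A$ is invertible and $$\lim_{k\to\infty}\frac{x(k)}{P(Y=k)}=\bigl[x(0)C_B+\overline x(0)C_A\bigr](I-A)^{-1}>0,$$ where the inequality holds in every component. -/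

import Mathlib

open Filter Topology MeasureTheory
open scoped ENNReal NNReal Matrix

noncomputable section

namespace GIG1

/-! ### Markov chains on a countable state space -/

section Chains

variable {S : Type*}

/-- Row-stochastic matrix on a possibly infinite state space. -/
structure IsStochastic (T : Matrix S S ℝ) : Prop where
  nonneg : ∀ s t, 0 ≤ T s t
  row_sum : ∀ s, HasSum (fun t => T s t) 1

/-- `firstPassage T n s t` is the probability that the chain started in `s` visits `t` at time `n`
and at none of the times `1, …, n - 1` (and it is `0` for `n = 0`). -/
def firstPassage (T : Matrix S S ℝ) : ℕ → S → S → ℝ≥0∞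
  | 0, _, _ => 0
  | 1, s, t => ENNReal.ofReal (T s t)
  | n + 2, s, t => ∑' u : {u : S // u ≠ t}, ENNReal.ofReal (T s u) * firstPassage T (n + 1) u t

/-- Every state is positive recurrent: the return to it is certain and the mean return time is
finite. -/
def IsPositiveRecurrent (T : Matrix S S ℝ) : Prop :=
  ∀ s, ∑' n : ℕ, firstPassage T n s s = 1 ∧ ∑' n : ℕ, (n : ℝ≥0∞) * firstPassage T n s s < ∞

/-- `x` is a stationary probability distribution: `x ≥ 0`, `x e = 1` and `x T = x`. -/
structure IsStationaryDistribution (x : S → ℝ) (T : Matrix S S ℝ) : Prop where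
  nonneg : ∀ s, 0 ≤ x s
  total : HasSum x 1
  invariant : ∀ t, HasSum (fun s => x s * T s t) (x t)

end Chains

/-- A finite nonnegative matrix `A` with `A e ≤ e` and `A e ≠ e`. -/
structure IsStrictlySubstochastic {m : Type*} [Fintype m] (A : Matrix m m ℝ) : Prop where
  nonneg : ∀ i j, 0 ≤ A i j
  row_sum_le : ∀ i, ∑ j, A i j ≤ 1
  row_sum_ne : ∃ i, ∑ j, A i j ≠ 1

/-! ### Chains of GI/G/1 type -/

/-- The state space `({0} × {1, …, M₀}) ∪ (ℕ × {1, …, M})`: the state `Sum.inl i` is the state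
`(0, i)` of level `0`, and `Sum.inr (n, i)` is the state `(n + 1, i)` of level `n + 1`. -/
abbrev State (M₀ M : ℕ) : Type := Fin M₀ ⊕ (ℕ × Fin M)

/-- The blocks out of which the transition matrix is built. -/
structure Blocks (M₀ M : ℕ) where
  /-- `A k` for `k : ℤ` -/
  A : ℤ → Matrix (Fin M) (Fin M) ℝ
  /-- `B(0)` -/
  Bzero : Matrix (Fin M₀) (Fin M₀) ℝ
  /-- `Bup k` is `B(k)` for `k ≥ 1`; `Bup 0` plays no role. -/
  Bup : ℕ → Matrix (Fin M₀) (Fin M) ℝ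
  /-- `Bdown k` is `B(-k)` for `k ≥ 1`; `Bdown 0` plays no role. -/
  Bdown : ℕ → Matrix (Fin M) (Fin M₀) ℝ

namespace Blocks

variable {M₀ M : ℕ}

/-- The transition matrix: the block from level `k ≥ 1` to level `l ≥ 1` is `A(l - k)`, that from
level `0` to level `l` is `B(l)`, that from level `k` to level `0` is `B(-k)`. -/
def T (D : Blocks M₀ M) : Matrix (State M₀ M) (State M₀ M) ℝ
  | Sum.inl i, Sum.inl j => D.Bzero i j
  | Sum.inl i, Sum.inr (l, j) => D.Bup (l + 1) i j
  | Sum.inr (k, i), Sum.inl j => D.Bdown (k + 1) i j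
  | Sum.inr (k, i), Sum.inr (l, j) => D.A ((l : ℤ) - (k : ℤ)) i j

/-- `A = ∑_{k ∈ ℤ} A(k)`. -/
def Asum (D : Blocks M₀ M) : Matrix (Fin M) (Fin M) ℝ :=
  Matrix.of fun i j => ∑' k : ℤ, D.A k i j

/-- The convergence radius of the matrix power series `∑_{k ≥ 1} z ^ k A(-k)`. -/
def radiusAneg (D : Blocks M₀ M) : ℝ≥0∞ :=
  ⨆ (r : ℝ≥0) (_ : ∀ i j, Summable fun k : ℕ => (r : ℝ) ^ (k + 1) * |D.A (-((k : ℤ) + 1)) i j|),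
    (r : ℝ≥0∞)

end Blocks

section Vectors

variable {M₀ M : ℕ}

/-- The part `x(0)` of a vector on level `0`. -/
def levelZero (x : State M₀ M → ℝ) : Fin M₀ → ℝ := fun i => x (Sum.inl i)

/-- The part `x(n + 1)` of a vector on level `n + 1`. -/
def levelSucc (x : State M₀ M → ℝ) (n : ℕ) : Fin M → ℝ := fun i => x (Sum.inr (n, i))

/-- `∑_{l ≥ 1} x(l)`. -/
def tailZero (x : State M₀ M → ℝ) : Fin M → ℝ := fun i => ∑' n : ℕ, levelSucc x n i

end Vectors

/-! ### Locally subexponential laws on the nonnegative integers -/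

/-- The integers in `k + Δ_h = (k, k + h]`. -/
def window (h : ℕ∞) (k : ℕ) : Set ℕ := {n | k < n ∧ (n : ℕ∞) ≤ (k : ℕ∞) + h}

/-- The class of locally long-tailed laws with span `h`. -/
def IsLocallyLongTailed (μ : Measure ℕ) (h : ℕ∞) : Prop :=
  (∀ᶠ k in atTop, 0 < μ.real (window h k)) ∧
    Tendsto (fun k => μ.real (window h (k + 1)) / μ.real (window h k)) atTop (𝓝 1)

/-- The class of locally subexponential laws with span `h`; `μ.conv μ` is the law of the sum of
two independent copies. -/
def IsLocallySubexponential (μ : Measure ℕ) (h : ℕ∞) : Prop :=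
  IsLocallyLongTailed μ h ∧
    Tendsto (fun k => (μ.conv μ).real (window h k) / μ.real (window h k)) atTop (𝓝 2)

/-- The sequence is nonincreasing from some index on. -/
def EventuallyNonincreasing (p : ℕ → ℝ) : Prop := ∃ k₀, ∀ k ≥ k₀, p (k + 1) ≤ p k

end GIG1

end

namespace GIG1

/-! ### Irreducible nonnegative matrices -/

/-! Write `p n = P(Y = n)`. With a zero row put at level `0`, the balance equations become `X = b +
X * A` on the half line, where `b n = x(0) B(n)` is asymptotic to `p n • x(0) C_B`. The principle of
one big jump evaluates `X * A` at `n`: either the kernel jumps far from a low level, contributing `p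
n • (∑ X) C_A`, or `X` is already near `n`; if `X n ~ p n • y`, this contributes `p n • y A`. All
other pairs are negligible (`IsJumpKernel.farTerm_le`, quantified in
`IsJumpKernel.eventually_abs_conv_sub_le`). So `y` must solve `y = c + y A` with `c = x(0) C_B + (∑
X) C_A`, that is `y = c (1 - A)⁻¹`.

Two steps make this rigorous, both resting on the fact that `v ≤ v A` with `v ≥ 0` forces `v = 0`
for irreducible strictly substochastic `A` (`IsStrictlySubstochastic.eq_zero_of_le_vecMul`). A
priori bound (`exists_eventually_le_mul`): the excess of `X` over a supersolution proportional to
`p` has total mass `v` with `v ≤ v A`, hence vanishes, and `X = O(p)`. Convergence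
(`tendsto_div_of_eq_add_conv`): the vector `s` of limits superior of `|X / p - y|` is finite and
satisfies `s ≤ s A`, so it is zero. -/

/-- A property that propagates along the positive entries of an irreducible matrix holds everywhere
as soon as it holds somewhere. -/
theorem irreducible_induction {S : Type*} {T : Matrix S S ℝ} (hT : T.IsIrreducible) {P : S → Prop}
    (step : ∀ s t, 0 < T s t → P s → P t) {s : S} (hs : P s) (t : S) : P t := by
  let : Quiver S := T.toQuiver
  obtain ⟨p, -⟩ := hT.connected s t
  induction p with
  | nil => exact hs
  | cons q e ih => exact step _ _ e.down ih

section Substochastic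

variable {ι : Type*} [Fintype ι] {A : Matrix ι ι ℝ}

/-- Summing over coordinates, the defects of `v ≤ v A` and of the row sums, the latter weighted by
`v`, cancel in total; being nonnegative, all vanish. Hence `v = v A`, so positivity of `v` would
spread to a row with sum below `1`, where `v` must be zero. -/
theorem IsStrictlySubstochastic.eq_zero_of_le_vecMul (hA : IsStrictlySubstochastic A)
    (hirr : A.IsIrreducible) {v : ι → ℝ} (hv : ∀ i, 0 ≤ v i) (hle : ∀ j, v j ≤ (v ᵥ* A) j) (j : ι) :
    v j = 0 := by
  have hsum : ∑ j, (v ᵥ* A) j = ∑ i, v i * ∑ j, A i j := by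
    simp only [Matrix.vecMul, dotProduct, Finset.mul_sum]
    exact Finset.sum_comm
  have h0 : ∑ j, (((v ᵥ* A) j - v j) + v j * (1 - ∑ l, A j l)) = 0 := by
    simp only [Finset.sum_add_distrib, Finset.sum_sub_distrib, hsum, mul_sub, mul_one]
    ring
  have hz := (Finset.sum_eq_zero_iff_of_nonneg (fun j _ => add_nonneg (sub_nonneg.2 (hle j))
    (mul_nonneg (hv j) (sub_nonneg.2 (hA.row_sum_le j))))).1 h0
  obtain ⟨i₀, hi₀⟩ := hA.row_sum_ne
  have hi₀' : 0 < 1 - ∑ l, A i₀ l := sub_pos.2 (lt_of_le_of_ne (hA.row_sum_le i₀) hi₀)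
  by_contra hj
  have hjpos : 0 < v j := lt_of_le_of_ne (hv j) (Ne.symm hj)
  have hall : 0 < v i₀ := by
    refine irreducible_induction hirr (P := fun i => 0 < v i) ?_ hjpos i₀
    intro s t hst hs
    have h1 := hz t (Finset.mem_univ _)
    have h2 := mul_nonneg (hv t) (sub_nonneg.2 (hA.row_sum_le t))
    have h3 : v s * A s t ≤ (v ᵥ* A) t :=
      Finset.single_le_sum (f := fun i => v i * A i t)
        (fun i _ => mul_nonneg (hv i) (hA.nonneg i t)) (Finset.mem_univ s)
    have h4 := mul_pos hs hst
    linarith [hle t]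
  have h1 := hz i₀ (Finset.mem_univ _)
  have h2 := mul_pos hall hi₀'
  linarith [hle i₀]

/-- As `A ≥ 0`, the positive part of `w` inherits the inequality. -/
theorem IsStrictlySubstochastic.nonpos_of_le_vecMul (hA : IsStrictlySubstochastic A)
    (hirr : A.IsIrreducible) {w : ι → ℝ} (hle : ∀ j, w j ≤ (w ᵥ* A) j) (j : ι) : w j ≤ 0 := by
  have := hA.eq_zero_of_le_vecMul hirr (v := fun i => max (w i) 0) (fun i => le_max_right _ _)
    (fun j => max_le ((hle j).trans (Finset.sum_le_sum fun i _ =>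
      mul_le_mul_of_nonneg_right (le_max_left _ _) (hA.nonneg i j)))
      (Finset.sum_nonneg fun i _ => mul_nonneg (le_max_right _ _) (hA.nonneg i j))) j
  exact (le_max_left _ _).trans this.le

variable [DecidableEq ι]

theorem IsStrictlySubstochastic.isUnit_one_sub (hA : IsStrictlySubstochastic A)
    (hirr : A.IsIrreducible) : IsUnit (1 - A) := by
  rw [← Matrix.vecMul_injective_iff_isUnit]
  intro v w hvw
  have h : ∀ i, (v - w) i = ((v - w) ᵥ* A) i := by
    intro i
    have := congrFun hvw i
    simp only [Matrix.vecMul_sub, Matrix.vecMul_one, Matrix.sub_vecMul, Pi.sub_apply] at this ⊢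
    linarith
  have h' : ∀ i, (w - v) i = ((w - v) ᵥ* A) i := by
    intro i
    have := h i
    simp only [Matrix.sub_vecMul, Pi.sub_apply] at this ⊢
    linarith
  ext i
  have h1 := hA.nonpos_of_le_vecMul hirr (fun j => (h j).le) i
  have h2 := hA.nonpos_of_le_vecMul hirr (fun j => (h' j).le) i
  simp only [Pi.sub_apply] at h1 h2
  linarith

theorem IsStrictlySubstochastic.vecMul_inv_eq (hA : IsStrictlySubstochastic A)
    (hirr : A.IsIrreducible) (c : ι → ℝ) (j : ι) :
    (c ᵥ* (1 - A)⁻¹) j = c j + (c ᵥ* (1 - A)⁻¹ ᵥ* A) j := by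
  have h : c ᵥ* (1 - A)⁻¹ ᵥ* (1 - A) = c := by
    rw [Matrix.vecMul_vecMul, Matrix.nonsing_inv_mul _
      ((Matrix.isUnit_iff_isUnit_det _).1 (hA.isUnit_one_sub hirr)), Matrix.vecMul_one]
  have := congrFun h j
  rw [Matrix.vecMul_sub, Matrix.vecMul_one, Pi.sub_apply] at this
  linarith

theorem IsStrictlySubstochastic.vecMul_inv_nonneg (hA : IsStrictlySubstochastic A)
    (hirr : A.IsIrreducible) {c : ι → ℝ} (hc : ∀ i, 0 ≤ c i) (j : ι) :
    0 ≤ (c ᵥ* (1 - A)⁻¹) j := by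
  have := hA.nonpos_of_le_vecMul hirr (w := -(c ᵥ* (1 - A)⁻¹)) (fun j => by
    rw [Matrix.neg_vecMul, Pi.neg_apply, Pi.neg_apply]
    linarith [hA.vecMul_inv_eq hirr c j, hc j]) j
  rw [Pi.neg_apply] at this
  linarith

theorem IsStrictlySubstochastic.vecMul_inv_pos (hA : IsStrictlySubstochastic A)
    (hirr : A.IsIrreducible) {c : ι → ℝ} (hc : ∀ i, 0 ≤ c i) {i : ι} (hi : 0 < c i) (j : ι) :
    0 < (c ᵥ* (1 - A)⁻¹) j := by
  have hnn := hA.vecMul_inv_nonneg hirr hc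
  have hterm : ∀ s t, (c ᵥ* (1 - A)⁻¹) s * A s t ≤ (c ᵥ* (1 - A)⁻¹ ᵥ* A) t := fun s t =>
    Finset.single_le_sum (f := fun i => (c ᵥ* (1 - A)⁻¹) i * A i t)
      (fun i _ => mul_nonneg (hnn i) (hA.nonneg i t)) (Finset.mem_univ s)
  refine irreducible_induction hirr (P := fun i => 0 < (c ᵥ* (1 - A)⁻¹) i) ?_ (s := i) ?_ j
  · intro s t hst hs
    have := mul_pos hs hst
    linarith [hterm s t, hA.vecMul_inv_eq hirr c t, hc t]
  · have := mul_nonneg (hnn i) (hA.nonneg i i)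
    linarith [hterm i i, hA.vecMul_inv_eq hirr c i]

end Substochastic

/-! ### Sequences with the one-big-jump property and kernels that are dominated by them -/

/-- A nonnegative summable sequence `p` with `p (n + 1) / p n → 1`. -/
structure IsLongTailedSeq (p : ℕ → ℝ) : Prop where
  nonneg : ∀ n, 0 ≤ p n
  summable : Summable p
  eventually_pos : ∀ᶠ n in atTop, 0 < p n
  ratio : Tendsto (fun n => p (n + 1) / p n) atTop (𝓝 1)

/-- A long-tailed sequence `p` for which the convolution square puts, up to a small multiple of
`p n`, all its mass on the pairs with one small entry. -/
structure IsSubexpSeq (p : ℕ → ℝ) : Prop extends IsLongTailedSeq p where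
  middle : ∀ ε > 0, ∃ K₀, ∀ K ≥ K₀, ∀ᶠ n in atTop,
    ∑ k ∈ Finset.Ioo K (n - K), p k * p (n - k) ≤ ε * p n

/-- A nonnegative summable kernel on `ℤ` which is asymptotic to `C p` at `+∞`, and whose left tail
is compatible with `p`. -/
structure IsJumpKernel (p : ℕ → ℝ) (a : ℤ → ℝ) (C : ℝ) : Prop where
  nonneg : ∀ m, 0 ≤ a m
  summable : Summable a
  tendsto : Tendsto (fun n : ℕ => a n / p n) atTop (𝓝 C)
  lower : ∃ r : ℝ, 0 ≤ r ∧ Summable (fun l : ℕ => r ^ l * a (-l)) ∧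
    ∀ᶠ n in atTop, p (n + 1) ≤ r * p n

namespace IsLongTailedSeq

variable {p : ℕ → ℝ}

theorem tendsto_add_div (hp : IsLongTailedSeq p) (j : ℕ) :
    Tendsto (fun n => p (n + j) / p n) atTop (𝓝 1) := by
  induction j with
  | zero =>
    refine tendsto_const_nhds.congr' ?_
    filter_upwards [hp.eventually_pos] with n hn
    simp [hn.ne']
  | succ j ih =>
    have h := ((hp.ratio.comp (tendsto_add_atTop_nat j)).mul ih)
    rw [one_mul] at h
    refine h.congr' ?_
    filter_upwards [(tendsto_add_atTop_nat j).eventually hp.eventually_pos] with n hn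
    simp only [Function.comp_apply, ← add_assoc]
    field_simp

/-- `toNat` truncates only for `n < l`, which does not affect the limit. -/
theorem tendsto_sub_div (hp : IsLongTailedSeq p) (l : ℤ) :
    Tendsto (fun n : ℕ => p (n - l).toNat / p n) atTop (𝓝 1) := by
  rcases le_total 0 l with hl | hl
  · obtain ⟨j, rfl⟩ := Int.eq_ofNat_of_zero_le hl
    rw [← tendsto_add_atTop_iff_nat j]
    have h := (hp.tendsto_add_div j).inv₀ one_ne_zero
    rw [inv_one] at h
    refine h.congr fun n => ?_
    rw [inv_div]
    congr 2
    lia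
  · obtain ⟨j, hj⟩ := Int.eq_ofNat_of_zero_le (neg_nonneg.2 hl)
    refine (hp.tendsto_add_div j).congr fun n => ?_
    congr 2
    lia

theorem bddAbove (hp : IsLongTailedSeq p) : ∃ B, ∀ n, p n ≤ B :=
  ⟨∑' n, p n, fun n => hp.summable.le_tsum n fun m _ => hp.nonneg m⟩

end IsLongTailedSeq

/-- The part of the convolution of `h` and `a` at `n` that comes from the pairs `(k, n - k)` with
`k > K` and `|n - k| > K`. -/
noncomputable def farTerm (h : ℕ → ℝ) (a : ℤ → ℝ) (K n k : ℕ) : ℝ :=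
  if K < k ∧ (k + K < n ∨ n + K < k) then h k * a (n - k) else 0

namespace IsJumpKernel

variable {p : ℕ → ℝ} {a : ℤ → ℝ} {C : ℝ}

theorem injective_sub (n : ℕ) : Function.Injective fun k : ℕ => (n : ℤ) - k := fun k l h => by
  simpa using h

theorem summable_conv (ha : IsJumpKernel p a C) {h : ℕ → ℝ} {B : ℝ} (hB : ∀ k, |h k| ≤ B) (n : ℕ) :
    Summable fun k : ℕ => h k * a (n - k) := by
  refine Summable.of_norm_bounded
    ((ha.summable.comp_injective (injective_sub n)).mul_left B) fun k => ?_
  rw [Real.norm_eq_abs, abs_mul, abs_of_nonneg (ha.nonneg _)]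
  exact mul_le_mul_of_nonneg_right (hB k) (ha.nonneg _)

theorem farTerm_summable (ha : IsJumpKernel p a C) {h : ℕ → ℝ} {B : ℝ} (hB : ∀ k, |h k| ≤ B)
    (K n : ℕ) : Summable (farTerm h a K n) := by
  refine Summable.of_norm_bounded (ha.summable_conv hB n).abs fun k => ?_
  unfold farTerm
  split_ifs
  · exact le_rfl
  · rw [norm_zero]; positivity

theorem constant_nonneg (hp : IsSubexpSeq p) (ha : IsJumpKernel p a C) : 0 ≤ C :=
  ge_of_tendsto' ha.tendsto fun n => div_nonneg (ha.nonneg _) (hp.nonneg n)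

/-- Far pairs contribute little. -/
theorem farTerm_le (hp : IsSubexpSeq p) (ha : IsJumpKernel p a C) {ε : ℝ} (hε : 0 < ε) :
    ∃ K₀, ∀ K ≥ K₀, ∀ᶠ n in atTop, ∑' k, farTerm p a K n k ≤ ε * p n := by
  have hC := ha.constant_nonneg hp
  obtain ⟨r, hr0, hrs, hrp⟩ := ha.lower
  -- Far out, `a ≤ (C + 1) p`; the tolerance is divided accordingly, leaving `ε / 2` for each of the
  -- two kinds of far pairs.
  obtain ⟨K₁, hK₁⟩ := hp.middle (ε / 2 / (C + 1)) (by positivity)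
  obtain ⟨K₂, hK₂⟩ := eventually_atTop.1
    ((ha.tendsto.eventually_lt_const (lt_add_one C)).and hp.eventually_pos)
  obtain ⟨K₃, hK₃⟩ := eventually_atTop.1
    ((tendsto_sum_nat_add fun l : ℕ => r ^ l * a (-l)).eventually_lt_const (half_pos hε))
  obtain ⟨N, hN⟩ := eventually_atTop.1 hrp
  refine ⟨K₁ + K₂ + K₃, fun K hK => ?_⟩
  obtain ⟨B, hB⟩ := hp.bddAbove
  have hpB : ∀ k, |p k| ≤ B := fun k => by rw [abs_of_nonneg (hp.nonneg k)]; exact hB k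
  filter_upwards [hK₁ K (by lia), eventually_ge_atTop N, eventually_ge_atTop K] with n hn hnN hnK
  have hpow : ∀ l, p (n + l) ≤ r ^ l * p n := by
    intro l
    induction l with
    | zero => simp
    | succ l ih =>
      calc p (n + l + 1) ≤ r * p (n + l) := hN _ (by lia)
        _ ≤ r * (r ^ l * p n) := mul_le_mul_of_nonneg_left ih hr0
        _ = r ^ (l + 1) * p n := by ring
  -- `F₁` collects the upward jumps, controlled by `middle`; `F₂` the downward ones, where `p k ≤ r
  -- ^ (k - n) * p n` and the tail of `∑ r ^ l * a (-l)` is small.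
  set F₁ : ℕ → ℝ := fun k => if k ∈ Finset.Ioo K (n - K) then p k * a (n - k) else 0 with hF₁
  set F₂ : ℕ → ℝ := fun k => if n + K < k then p k * a (n - k) else 0 with hF₂
  have hs := ha.summable_conv hpB n
  have hs₁ : Summable F₁ := summable_of_ne_finset_zero (s := Finset.Ioo K (n - K)) fun k hk =>
    if_neg hk
  have hs₂ : Summable F₂ := by
    refine Summable.of_norm_bounded hs.abs fun k => ?_
    simp only [hF₂]
    split_ifs
    · exact le_rfl
    · rw [norm_zero]; positivity
  have hfar : ∀ k, farTerm p a K n k = F₁ k + F₂ k := by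
    intro k
    simp only [farTerm, hF₁, hF₂, Finset.mem_Ioo]
    by_cases h1 : K < k ∧ k < n - K
    · rw [if_pos ⟨h1.1, Or.inl (by lia)⟩, if_pos h1, if_neg (by lia), add_zero]
    · by_cases h2 : n + K < k
      · rw [if_pos ⟨by lia, Or.inr h2⟩, if_neg h1, if_pos h2, zero_add]
      · rw [if_neg (by lia), if_neg h1, if_neg h2, add_zero]
  have e₁ : ∑' k, F₁ k ≤ ε / 2 * p n := by
    rw [tsum_eq_sum (s := Finset.Ioo K (n - K)) fun k hk => if_neg hk]
    calc ∑ k ∈ Finset.Ioo K (n - K), F₁ k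
        ≤ ∑ k ∈ Finset.Ioo K (n - K), (C + 1) * (p k * p (n - k)) := by
          refine Finset.sum_le_sum fun k hk => ?_
          simp only [hF₁, if_pos hk]
          rw [Finset.mem_Ioo] at hk
          obtain ⟨h1, h2⟩ := hK₂ (n - k) (by lia)
          rw [div_lt_iff₀ h2] at h1
          have h3 : ((n - k : ℕ) : ℤ) = n - k := by lia
          rw [h3] at h1
          calc p k * a (n - k) ≤ p k * ((C + 1) * p (n - k)) :=
                mul_le_mul_of_nonneg_left h1.le (hp.nonneg k)
            _ = _ := by ring
      _ = (C + 1) * ∑ k ∈ Finset.Ioo K (n - K), p k * p (n - k) := by rw [Finset.mul_sum]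
      _ ≤ (C + 1) * (ε / 2 / (C + 1) * p n) := by gcongr
      _ = ε / 2 * p n := by field_simp
  have e₂ : ∑' k, F₂ k ≤ ε / 2 * p n := by
    have hinj : Function.Injective fun m : ℕ => n + (m + (K + 1)) := fun m m' h => by
      simpa using h
    have hsupp : Function.support F₂ ⊆ Set.range fun m : ℕ => n + (m + (K + 1)) := by
      intro k hk
      have : n + K < k := by
        by_contra h
        exact hk (if_neg h)
      exact ⟨k - n - (K + 1), by simp only; lia⟩
    rw [← hinj.tsum_eq hsupp]
    have hs₃ : Summable fun m : ℕ => r ^ (m + (K + 1)) * a (-((m + (K + 1) : ℕ) : ℤ)) :=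
      hrs.comp_injective (add_left_injective (K + 1))
    calc ∑' m : ℕ, F₂ (n + (m + (K + 1)))
        ≤ ∑' m : ℕ, p n * (r ^ (m + (K + 1)) * a (-((m + (K + 1) : ℕ) : ℤ))) := by
          refine Summable.tsum_le_tsum (fun m => ?_) (hs₂.comp_injective hinj) (hs₃.mul_left _)
          simp only [hF₂]
          rw [if_pos (by lia)]
          have h3 : (n : ℤ) - ((n + (m + (K + 1)) : ℕ) : ℤ) = -((m + (K + 1) : ℕ) : ℤ) := by lia
          rw [h3]
          calc _ ≤ (r ^ (m + (K + 1)) * p n) * a (-((m + (K + 1) : ℕ) : ℤ)) :=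
                mul_le_mul_of_nonneg_right (hpow _) (ha.nonneg _)
            _ = _ := by ring
      _ = p n * ∑' m : ℕ, r ^ (m + (K + 1)) * a (-((m + (K + 1) : ℕ) : ℤ)) := tsum_mul_left
      _ ≤ p n * (ε / 2) := by
          gcongr
          · exact hp.nonneg n
          · exact (hK₃ (K + 1) (by lia)).le
      _ = ε / 2 * p n := mul_comm _ _
  calc ∑' k, farTerm p a K n k = ∑' k, F₁ k + ∑' k, F₂ k := by
        rw [← hs₁.tsum_add hs₂]
        exact tsum_congr hfar
    _ ≤ ε / 2 * p n + ε / 2 * p n := add_le_add e₁ e₂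
    _ = ε * p n := by ring

theorem window_sum_eq (h : ℕ → ℝ) (a : ℤ → ℝ) {K n : ℕ} (hn : K ≤ n) :
    ∑ k ∈ Finset.Icc (n - K) (n + K), h k * a (n - k) =
      ∑ l ∈ Finset.Icc (-K : ℤ) K, h (n - l).toNat * a l := by
  refine Finset.sum_nbij' (fun k : ℕ => (n : ℤ) - k) (fun l => ((n : ℤ) - l).toNat) ?_ ?_ ?_ ?_ ?_
  · intro k hk; simp only [Finset.mem_Icc] at *; lia
  · intro k hk; simp only [Finset.mem_Icc] at *; lia
  · intro k hk; simp only [Finset.mem_Icc] at *; lia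
  · intro k hk; simp only [Finset.mem_Icc] at *; lia
  · intro k hk
    congr 2
    lia

theorem tendsto_window (hp : IsSubexpSeq p) (K : ℕ) :
    Tendsto (fun n : ℕ => (∑ l ∈ Finset.Icc (-K : ℤ) K, p (n - l).toNat * a l) / p n) atTop
      (𝓝 (∑ l ∈ Finset.Icc (-K : ℤ) K, a l)) := by
  simp only [Finset.sum_div]
  refine tendsto_finsetSum _ fun l _ => ?_
  have := (hp.tendsto_sub_div l).mul_const (a l)
  rw [one_mul] at this
  refine this.congr fun n => ?_
  ring

theorem tendsto_symmetric_sum (ha : IsJumpKernel p a C) :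
    Tendsto (fun K : ℕ => ∑ l ∈ Finset.Icc (-K : ℤ) K, a l) atTop (𝓝 (∑' m, a m)) := by
  refine ha.summable.hasSum.comp (tendsto_atTop_finset_of_monotone ?_ fun m => ?_)
  · intro K L h
    exact Finset.Icc_subset_Icc (by lia) (by lia)
  · exact ⟨m.natAbs, by simp only [Finset.mem_Icc]; lia⟩

/-- The kernel makes the big jump: for each fixed `k`, `a (n - k) ~ C p (n - k) ~ C p n`. -/
theorem tendsto_head (hp : IsSubexpSeq p) (ha : IsJumpKernel p a C) (h : ℕ → ℝ) (K : ℕ) :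
    Tendsto (fun n : ℕ => (∑ k ∈ Finset.range (K + 1), h k * a (n - k)) / p n) atTop
      (𝓝 (C * ∑ k ∈ Finset.range (K + 1), h k)) := by
  simp only [Finset.sum_div, Finset.mul_sum]
  refine tendsto_finsetSum _ fun k _ => ?_
  have h1 : Tendsto (fun n : ℕ => a (n - k) / p (n - (k : ℤ)).toNat) atTop (𝓝 C) := by
    rw [← tendsto_add_atTop_iff_nat k]
    refine ha.tendsto.congr fun n => ?_
    congr 2 <;> lia
  have h2 := (h1.mul (hp.tendsto_sub_div k)).mul_const (h k)
  rw [mul_one] at h2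
  refine h2.congr' ?_
  have : ∀ᶠ n : ℕ in atTop, 0 < p (n - (k : ℤ)).toNat := by
    obtain ⟨N, hN⟩ := eventually_atTop.1 hp.eventually_pos
    filter_upwards [eventually_ge_atTop (N + k)] with n hn
    exact hN _ (by lia)
  filter_upwards [this] with n hn
  field_simp

/-- The convolution of a sequence close to `y p` with the kernel `a`: either the sequence or the
kernel makes the big jump. -/
theorem eventually_abs_conv_sub_le (hp : IsSubexpSeq p) (ha : IsJumpKernel p a C) {h : ℕ → ℝ}
    (hs : Summable h) {y s : ℝ} (hs0 : 0 ≤ s) (hb : ∀ᶠ k in atTop, |h k - y * p k| ≤ s * p k)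
    {ε : ℝ} (hε : 0 < ε) :
    ∀ᶠ n : ℕ in atTop, |∑' k : ℕ, h k * a (n - k) - p n * (C * ∑' k, h k + y * ∑' m, a m)| ≤
      p n * (s * ∑' m, a m + ε) := by
  -- The errors are `δ` from the head, `|y| δ + s δ` from the window and `(|y| + s) δ` from the far
  -- pairs, each times `p n`.
  set δ := ε / (2 * s + 2 * |y| + 1) with hδ
  have hδ0 : 0 < δ := by positivity
  obtain ⟨N, hN⟩ := eventually_atTop.1 hb
  obtain ⟨B, hB⟩ : ∃ B, ∀ k, |h k| ≤ B := ⟨∑' k, |h k|, fun k =>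
    hs.abs.le_tsum k fun _ _ => abs_nonneg _⟩
  obtain ⟨Bp, hBp⟩ := hp.bddAbove
  have hpB : ∀ k, |p k| ≤ Bp := fun k => by rw [abs_of_nonneg (hp.nonneg k)]; exact hBp k
  obtain ⟨K₀, hK₀⟩ := ha.farTerm_le hp hδ0
  have hhead : Tendsto (fun K => C * ∑ k ∈ Finset.range (K + 1), h k) atTop
      (𝓝 (C * ∑' k, h k)) :=
    (hs.hasSum.tendsto_sum_nat.comp (tendsto_add_atTop_nat 1)).const_mul C
  -- `K ≥ N` makes the comparison of `h` with `y p` available at every far index.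
  obtain ⟨K, hKK₀, hKN, hKh, hKw⟩ := ((eventually_ge_atTop K₀).and ((eventually_ge_atTop N).and
    ((Metric.tendsto_nhds.1 hhead δ hδ0).and
      (Metric.tendsto_nhds.1 ha.tendsto_symmetric_sum δ hδ0)))).exists
  have hfar := hK₀ K hKK₀
  have h1 : ∀ᶠ n : ℕ in atTop,
      |(∑ k ∈ Finset.range (K + 1), h k * a (n - k)) / p n - C * ∑' k, h k| < δ :=
    (((ha.tendsto_head hp h K).sub_const _).abs).eventually_lt_const hKh
  have h2 : ∀ᶠ n : ℕ in atTop,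
      |(∑ l ∈ Finset.Icc (-K : ℤ) K, p (n - l).toNat * a l) / p n - ∑' m, a m| < δ :=
    (((tendsto_window hp K).sub_const _).abs).eventually_lt_const hKw
  filter_upwards [hfar, h1, h2, hp.eventually_pos, eventually_gt_atTop (2 * K + N)] with
    n hfar h1 h2 hpn hn
  set H := ∑ k ∈ Finset.range (K + 1), h k * a (n - k) with hH
  set W := ∑ l ∈ Finset.Icc (-K : ℤ) K, h (n - l).toNat * a l with hW
  set V := ∑ l ∈ Finset.Icc (-K : ℤ) K, p (n - l).toNat * a l with hV
  -- Head `k ≤ K`, window `|n - k| ≤ K`, and far pairs. Since `n > 2 K + N`, head and window are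
  -- disjoint and the window lies beyond `N`.
  have hsplit : ∑' k : ℕ, h k * a (n - k) = H + W + ∑' k, farTerm h a K n k := by
    set S := Finset.range (K + 1) ∪ Finset.Icc (n - K) (n + K) with hS
    have hdisj : Disjoint (Finset.range (K + 1)) (Finset.Icc (n - K) (n + K)) := by
      rw [Finset.disjoint_left]
      intro k hk hk'
      simp only [Finset.mem_range, Finset.mem_Icc] at hk hk'
      lia
    have hSsum : ∑' k, (if k ∈ S then h k * a (n - k) else 0) = H + W := by
      rw [tsum_eq_sum (s := S) fun k hk => if_neg hk, hH, hW, ← window_sum_eq h a (by lia),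
        ← Finset.sum_union hdisj]
      exact Finset.sum_congr rfl fun k hk => if_pos hk
    rw [← hSsum, ← Summable.tsum_add (summable_of_ne_finset_zero (s := S) fun k hk => if_neg hk)
      (ha.farTerm_summable hB K n)]
    refine tsum_congr fun k => ?_
    simp only [farTerm, hS, Finset.mem_union, Finset.mem_range, Finset.mem_Icc]
    by_cases hk : k < K + 1 ∨ n - K ≤ k ∧ k ≤ n + K
    · rw [if_pos hk, if_neg (by lia), add_zero]
    · rw [if_neg hk, if_pos (by lia), zero_add]
  have hV0 : V / p n < ∑' m, a m + δ := by linarith [(abs_lt.1 h2).2]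
  have hV1 : V ≤ p n * (∑' m, a m + δ) := by
    rw [div_lt_iff₀ hpn] at hV0
    linarith
  have eH : |H - p n * (C * ∑' k, h k)| ≤ p n * δ := by
    have : H - p n * (C * ∑' k, h k) = p n * (H / p n - C * ∑' k, h k) := by field_simp
    rw [this, abs_mul, abs_of_pos hpn]
    exact mul_le_mul_of_nonneg_left h1.le hpn.le
  have eV : |V - p n * ∑' m, a m| ≤ p n * δ := by
    have : V - p n * ∑' m, a m = p n * (V / p n - ∑' m, a m) := by field_simp
    rw [this, abs_mul, abs_of_pos hpn]
    exact mul_le_mul_of_nonneg_left h2.le hpn.le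
  have eW : |W - y * V| ≤ s * V := by
    rw [hW, hV, Finset.mul_sum, Finset.mul_sum, ← Finset.sum_sub_distrib]
    refine (Finset.abs_sum_le_sum_abs _ _).trans (Finset.sum_le_sum fun l hl => ?_)
    rw [Finset.mem_Icc] at hl
    have := hN (n - l).toNat (by lia)
    rw [← mul_assoc, ← sub_mul, abs_mul, abs_of_nonneg (ha.nonneg l), ← mul_assoc]
    exact mul_le_mul_of_nonneg_right this (ha.nonneg l)
  have eF : |∑' k, farTerm h a K n k| ≤ (|y| + s) * (δ * p n) := by
    have hle : ∀ k, |farTerm h a K n k| ≤ (|y| + s) * farTerm p a K n k := by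
      intro k
      unfold farTerm
      split_ifs with hk
      · rw [abs_mul, abs_of_nonneg (ha.nonneg _), ← mul_assoc]
        refine mul_le_mul_of_nonneg_right ?_ (ha.nonneg _)
        have h3 := hN k (by lia)
        have h4 : |h k| ≤ |h k - y * p k| + |y * p k| := by
          simpa using abs_add_le (h k - y * p k) (y * p k)
        rw [abs_mul, abs_of_nonneg (hp.nonneg k)] at h4
        linarith
      · simp
    have hsum := ha.farTerm_summable hB K n
    calc |∑' k, farTerm h a K n k| ≤ ∑' k, |farTerm h a K n k| := by
          simpa only [Real.norm_eq_abs] using norm_tsum_le_tsum_norm hsum.norm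
      _ ≤ ∑' k, (|y| + s) * farTerm p a K n k :=
          hsum.abs.tsum_le_tsum hle ((ha.farTerm_summable hpB K n).mul_left _)
      _ = (|y| + s) * ∑' k, farTerm p a K n k := tsum_mul_left
      _ ≤ (|y| + s) * (δ * p n) := by gcongr
  have hεδ : ε = (2 * s + 2 * |y| + 1) * δ := by rw [hδ]; field_simp
  have hdecomp : ∑' k : ℕ, h k * a (n - k) - p n * (C * ∑' k, h k + y * ∑' m, a m) =
      (H - p n * (C * ∑' k, h k)) + (W - y * V) + y * (V - p n * ∑' m, a m) +
        ∑' k, farTerm h a K n k := by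
    rw [hsplit]; ring
  have eyV : |y * (V - p n * ∑' m, a m)| ≤ |y| * (p n * δ) := by
    rw [abs_mul]
    exact mul_le_mul_of_nonneg_left eV (abs_nonneg y)
  have hsV : s * V ≤ s * (p n * (∑' m, a m + δ)) := mul_le_mul_of_nonneg_left hV1 hs0
  rw [hdecomp, hεδ]
  refine ((abs_add_le _ _).trans (add_le_add_left ((abs_add_le _ _).trans
    (add_le_add_left (abs_add_le _ _) _)) _)).trans ?_
  linarith

/-- The restriction of `p` to `(N, ∞)` is almost invariant under convolution with `a`, with an error
that is uniform on `(N, ∞)`. -/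
theorem exists_tail_conv_le (hp : IsSubexpSeq p) (ha : IsJumpKernel p a C) {ε : ℝ} (hε : 0 < ε) :
    ∀ᶠ N in atTop, ∀ n > N, ∑' k : ℕ, (if N < k then p k else 0) * a (n - k) ≤
      p n * (∑' m, a m + ε) := by
  obtain ⟨K, hK⟩ := ha.farTerm_le hp (half_pos hε)
  obtain ⟨Bp, hBp⟩ := hp.bddAbove
  have hpB : ∀ k, |p k| ≤ Bp := fun k => by rw [abs_of_nonneg (hp.nonneg k)]; exact hBp k
  have hw : ∑ l ∈ Finset.Icc (-K : ℤ) K, a l < ∑' m, a m + ε / 2 := by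
    linarith [ha.summable.sum_le_tsum (Finset.Icc (-K : ℤ) K) fun m _ => ha.nonneg m]
  obtain ⟨N₀, hN₀⟩ := eventually_atTop.1 ((hK K le_rfl).and
    (((tendsto_window (a := a) hp K).eventually_lt_const hw).and hp.eventually_pos))
  -- Since `N ≥ K`, cutting at `N` removes the head: no term with `C` survives, and both remaining
  -- estimates hold for all `n ≥ N₀`.
  filter_upwards [eventually_ge_atTop (N₀ + K)] with N hN n hn
  obtain ⟨hfar, hwin, hpn⟩ := hN₀ n (by lia)
  rw [div_lt_iff₀ hpn, ← window_sum_eq p a (by lia)] at hwin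
  set S := Finset.Icc (n - K) (n + K) with hS
  have hs₁ : Summable fun k => if k ∈ S then p k * a (n - k) else 0 :=
    summable_of_ne_finset_zero (s := S) fun k hk => if_neg hk
  have hs₂ := ha.farTerm_summable hpB K n
  have hle : ∀ k : ℕ, (if N < k then p k else 0) * a (n - k) ≤
      (if k ∈ S then p k * a (n - k) else 0) + farTerm p a K n k := by
    intro k
    have hnn : 0 ≤ p k * a (n - k) := mul_nonneg (hp.nonneg k) (ha.nonneg _)
    simp only [farTerm, hS, Finset.mem_Icc]
    by_cases hk : N < k
    · rw [if_pos hk]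
      by_cases hk' : n - K ≤ k ∧ k ≤ n + K
      · rw [if_pos hk', if_neg (by lia), add_zero]
      · rw [if_neg hk', if_pos (by lia), zero_add]
    · rw [if_neg hk, zero_mul]
      split_ifs <;> simp [hnn]
  have hs₀ : Summable fun k : ℕ => (if N < k then p k else 0) * a (n - k) := by
    refine ha.summable_conv (B := Bp) (fun k => ?_) n
    split_ifs
    · exact hpB k
    · simpa using (abs_nonneg _).trans (hpB k)
  calc ∑' k : ℕ, (if N < k then p k else 0) * a (n - k)
      ≤ ∑' k : ℕ, ((if k ∈ S then p k * a (n - k) else 0) + farTerm p a K n k) :=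
        hs₀.tsum_le_tsum hle (hs₁.add hs₂)
    _ = ∑ k ∈ S, p k * a (n - k) + ∑' k, farTerm p a K n k := by
        rw [hs₁.tsum_add hs₂, tsum_eq_sum (s := S) fun k hk => if_neg hk]
        congr 1
        exact Finset.sum_congr rfl fun k hk => if_pos hk
    _ ≤ (∑' m, a m + ε / 2) * p n + ε / 2 * p n := add_le_add hwin.le hfar
    _ = p n * (∑' m, a m + ε) := by ring

/-- The total mass of the part of a convolution that is carried by `ℕ`. -/
theorem summable_conv_and_tsum_le (ha : IsJumpKernel p a C) {d : ℕ → ℝ} (hd : ∀ k, 0 ≤ d k)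
    (hs : Summable d) :
    (Summable fun n : ℕ => ∑' k : ℕ, d k * a (n - k)) ∧
      ∑' n : ℕ, ∑' k : ℕ, d k * a (n - k) ≤ (∑' k, d k) * ∑' m, a m := by
  have hprod : Summable fun q : ℕ × ℤ => d q.1 * a q.2 :=
    hs.mul_of_nonneg ha.summable hd ha.nonneg
  -- `(n, k) ↦ (k, n - k)` embeds the pairs into the full product; the pairs landing below zero are
  -- lost, whence an inequality.
  have hinj : Function.Injective fun q : ℕ × ℕ => ((q.2, (q.1 : ℤ) - q.2) : ℕ × ℤ) := by
    rintro ⟨n, k⟩ ⟨n', k'⟩ h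
    simp only [Prod.mk.injEq] at h ⊢
    lia
  have hcomp : Summable fun q : ℕ × ℕ => d q.2 * a (q.1 - q.2) := hprod.comp_injective hinj
  refine ⟨hcomp.prod, ?_⟩
  rw [← hcomp.tsum_prod, hs.tsum_mul_tsum ha.summable hprod]
  exact tsum_comp_le_tsum_of_inj hprod (fun q => mul_nonneg (hd _) (ha.nonneg _)) hinj

end IsJumpKernel

/-! ### Wiener–Hopf type equations on the half line -/

section HalfLine

variable {ι : Type*} [Fintype ι] {p : ℕ → ℝ} {A : ℤ → Matrix ι ι ℝ} {C S : Matrix ι ι ℝ}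
  {X b : ℕ → ι → ℝ} {β : ι → ℝ}

/-- A nonnegative summable solution of `X = b + X * A` on the half line is `O(p)`. -/
theorem exists_eventually_le_mul (hp : IsSubexpSeq p)
    (hA : ∀ i j, IsJumpKernel p (fun m => A m i j) (C i j))
    (hS : ∀ i j, ∑' m, A m i j = S i j)
    (hsub : IsStrictlySubstochastic S) (hirr : S.IsIrreducible)
    (hX0 : ∀ n i, 0 ≤ X n i) (hXs : ∀ i, Summable fun n => X n i)
    (hb : ∀ j, Tendsto (fun n => b n j / p n) atTop (𝓝 (β j)))
    (hX : ∀ n ≥ 1, ∀ j, X n j = b n j + ∑ i, ∑' k : ℕ, X k i * A (n - k) i j) :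
    ∃ B, ∀ᶠ n in atTop, ∀ j, X n j ≤ B * p n := by
  classical
  -- `v = e + v S` gives the supersolution `2 B v p`: its surplus `2 B p` pays `B p` for the forcing
  -- `b'` and `B p` for the convolution error, `ε` being chosen with `ε ∑ v ≤ 1 / 2`.
  set v : ι → ℝ := (fun _ => (1 : ℝ)) ᵥ* (1 - S)⁻¹ with hv
  have hv0 : ∀ j, 0 ≤ v j := hsub.vecMul_inv_nonneg hirr fun _ => zero_le_one
  have hv1 : ∀ j, v j = 1 + ∑ i, v i * S i j := hsub.vecMul_inv_eq hirr _
  have hV0 : 0 ≤ ∑ i, v i := Finset.sum_nonneg fun i _ => hv0 i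
  set ε : ℝ := 1 / (2 * (∑ i, v i + 1)) with hε
  have hε0 : 0 < ε := by positivity
  have hεV : 2 * (ε * ∑ i, v i) ≤ 1 := by
    have : 2 * (ε * ∑ i, v i) = (∑ i, v i) / (∑ i, v i + 1) := by rw [hε]; field_simp
    rw [this, div_le_one (by positivity)]
    linarith
  have htail : ∀ᶠ N in atTop, ∀ i j, ∀ n > N,
      ∑' k : ℕ, (if N < k then p k else 0) * A (n - k) i j ≤ p n * (S i j + ε) := by
    simp only [eventually_all]
    intro i j
    simpa only [hS i j] using (hA i j).exists_tail_conv_le hp hε0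
  obtain ⟨N₀, hN₀⟩ := eventually_atTop.1 hp.eventually_pos
  obtain ⟨N, htail, hNN₀⟩ := (htail.and (eventually_ge_atTop N₀)).exists
  -- The contribution of the levels up to `N` is itself `O(p)` and is absorbed into the forcing.
  set b' : ℕ → ι → ℝ := fun n j =>
    b n j + ∑ i, ∑ k ∈ Finset.range (N + 1), X k i * A (n - k) i j with hb'
  have hb't : ∀ j, ∃ B, ∀ n, b' n j / p n ≤ B := by
    intro j
    have h : Tendsto (fun n => b' n j / p n) atTop
        (𝓝 (β j + ∑ i, C i j * ∑ k ∈ Finset.range (N + 1), X k i)) := by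
      simp only [hb', add_div, Finset.sum_div Finset.univ]
      exact (hb j).add (tendsto_finsetSum _ fun i _ =>
        (hA i j).tendsto_head hp (fun k => X k i) N)
    obtain ⟨B, hB⟩ := h.bddAbove_range
    exact ⟨B, fun n => hB ⟨n, rfl⟩⟩
  choose B₀ hB₀ using hb't
  set B : ℝ := ∑ j, |B₀ j| with hB
  have hB0 : 0 ≤ B := Finset.sum_nonneg fun _ _ => abs_nonneg _
  have hBle : ∀ n > N, ∀ j, b' n j ≤ B * p n := by
    intro n hn j
    have h1 := (hB₀ j n).trans ((le_abs_self _).trans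
      (Finset.single_le_sum (f := fun j => |B₀ j|) (fun _ _ => abs_nonneg _) (Finset.mem_univ j)))
    rwa [div_le_iff₀ (hN₀ n (by lia))] at h1
  set d : ℕ → ι → ℝ := fun k i => if N < k then max (X k i - 2 * B * v i * p k) 0 else 0 with hd
  have hd0 : ∀ k i, 0 ≤ d k i := by
    intro k i
    simp only [hd]
    split_ifs
    · exact le_max_right _ _
    · exact le_rfl
  have hdX : ∀ k i, d k i ≤ X k i := by
    intro k i
    simp only [hd]
    split_ifs
    · refine max_le ?_ (hX0 k i)
      have := mul_nonneg (mul_nonneg (mul_nonneg zero_le_two hB0) (hv0 i)) (hp.nonneg k)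
      linarith
    · exact hX0 k i
  have hds : ∀ i, Summable fun k => d k i := fun i =>
    (hXs i).of_nonneg_of_le (fun k => hd0 k i) fun k => hdX k i
  have bound : ∀ {h : ℕ → ℝ}, (∀ k, 0 ≤ h k) → Summable h → ∃ B, ∀ k, |h k| ≤ B :=
    fun h0 hs => ⟨_, fun k => by
      rw [abs_of_nonneg (h0 k)]
      exact hs.le_tsum k fun m _ => h0 m⟩
  have hconv : ∀ {h : ℕ → ℝ}, (∀ k, 0 ≤ h k) → Summable h → ∀ i j (n : ℕ),
      Summable fun k : ℕ => h k * A (n - k) i j := fun h0 hs i j n =>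
    (hA i j).summable_conv (bound h0 hs).choose_spec n
  have hp' : Summable fun k => if N < k then p k else 0 :=
    hp.summable.of_nonneg_of_le (fun k => by split_ifs <;> simp [hp.nonneg])
      fun k => by split_ifs <;> simp [hp.nonneg]
  have hsupp : ∀ n > N, ∀ i j, ∑' k : ℕ, X k i * A (n - k) i j ≤
      ∑ k ∈ Finset.range (N + 1), X k i * A (n - k) i j +
        (∑' k : ℕ, d k i * A (n - k) i j + 2 * B * v i * (p n * (S i j + ε))) := by
    intro n hn i j
    have hs₁ : Summable fun k => if k ∈ Finset.range (N + 1) then X k i * A (n - k) i j else 0 :=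
      summable_of_ne_finset_zero (s := Finset.range (N + 1)) fun k hk => if_neg hk
    have hs₂ := hconv (fun k => hd0 k i) (hds i) i j n
    have hs₃ := (hconv (h := fun k => if N < k then p k else 0)
      (fun k => by split_ifs <;> simp [hp.nonneg]) hp' i j n).mul_left (2 * B * v i)
    calc ∑' k : ℕ, X k i * A (n - k) i j
        ≤ ∑' k : ℕ, ((if k ∈ Finset.range (N + 1) then X k i * A (n - k) i j else 0) +
          (d k i * A (n - k) i j +
            2 * B * v i * ((if N < k then p k else 0) * A (n - k) i j))) := by
          refine (hconv (fun k => hX0 k i) (hXs i) i j n).tsum_le_tsum (fun k => ?_)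
            (hs₁.add (hs₂.add hs₃))
          simp only [Finset.mem_range, hd]
          by_cases hk : N < k
          · rw [if_neg (by lia), if_pos hk, if_pos hk, zero_add, ← mul_assoc, ← add_mul]
            refine mul_le_mul_of_nonneg_right ?_ ((hA i j).nonneg _)
            linarith [le_max_left (X k i - 2 * B * v i * p k) 0]
          · rw [if_pos (by lia), if_neg hk, if_neg hk]
            simp
      _ = ∑ k ∈ Finset.range (N + 1), X k i * A (n - k) i j +
          (∑' k : ℕ, d k i * A (n - k) i j +
            2 * B * v i * ∑' k : ℕ, (if N < k then p k else 0) * A (n - k) i j) := by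
          rw [hs₁.tsum_add (hs₂.add hs₃), hs₂.tsum_add hs₃, tsum_mul_left,
            tsum_eq_sum (s := Finset.range (N + 1)) fun k hk => if_neg hk]
          congr 1
          exact Finset.sum_congr rfl fun k hk => if_pos hk
      _ ≤ _ := by
          have := mul_nonneg (mul_nonneg zero_le_two hB0) (hv0 i)
          gcongr
          exact htail i j n hn
  -- Subtracting the supersolution inequality cancels the forcing, so the excess satisfies the
  -- homogeneous inequality.
  have hdle : ∀ n j, d n j ≤ ∑ i, ∑' k : ℕ, d k i * A (n - k) i j := by
    intro n j
    have hnn : 0 ≤ ∑ i, ∑' k : ℕ, d k i * A (n - k) i j :=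
      Finset.sum_nonneg fun i _ => tsum_nonneg fun k =>
        mul_nonneg (hd0 k i) ((hA i j).nonneg _)
    by_cases hn : N < n
    · have hdn : d n j = max (X n j - 2 * B * v j * p n) 0 := if_pos hn
      rw [hdn]
      refine max_le ?_ hnn
      have h1 := Finset.sum_le_sum fun i (_ : i ∈ Finset.univ) => hsupp n hn i j
      rw [Finset.sum_add_distrib, Finset.sum_add_distrib] at h1
      have h2 := hBle n hn j
      have h3 : ∑ i, 2 * B * v i * (p n * (S i j + ε)) =
          2 * B * p n * (∑ i, v i * S i j) + B * p n * (2 * (ε * ∑ i, v i)) := by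
        simp only [Finset.mul_sum, ← Finset.sum_add_distrib]
        exact Finset.sum_congr rfl fun i _ => by ring
      have h4 : B * p n * (2 * (ε * ∑ i, v i)) ≤ B * p n * 1 :=
        mul_le_mul_of_nonneg_left hεV (mul_nonneg hB0 (hp.nonneg n))
      have h5 : 2 * B * v j * p n = 2 * B * p n + 2 * B * p n * ∑ i, v i * S i j := by
        rw [hv1 j]; ring
      simp only [hb'] at h2
      rw [hX n (by lia) j]
      linarith
    · have hdn : d n j = 0 := if_neg hn
      rw [hdn]
      exact hnn
  -- Summability of `X` makes the total excess finite, so summing over levels gives a vector `D`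
  -- with `D ≤ D S`.
  have hD : ∀ j, ∑' k, d k j = 0 := by
    refine hsub.eq_zero_of_le_vecMul hirr (fun i => tsum_nonneg fun k => hd0 k i) fun j => ?_
    have hmass := fun i => (hA i j).summable_conv_and_tsum_le (fun k => hd0 k i) (hds i)
    calc ∑' n, d n j ≤ ∑' n : ℕ, ∑ i, ∑' k : ℕ, d k i * A (n - k) i j :=
          (hds j).tsum_le_tsum (fun n => hdle n j) (summable_sum fun i _ => (hmass i).1)
      _ = ∑ i, ∑' n : ℕ, ∑' k : ℕ, d k i * A (n - k) i j :=
          Summable.tsum_finsetSum fun i _ => (hmass i).1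
      _ ≤ ∑ i, (∑' k, d k i) * S i j := by
          refine Finset.sum_le_sum fun i _ => ?_
          rw [← hS i j]
          exact (hmass i).2
  refine ⟨2 * B * ∑ i, v i, ?_⟩
  filter_upwards [eventually_gt_atTop N] with n hn j
  have h1 : d n j ≤ 0 := (hD j) ▸ (hds j).le_tsum n fun m _ => hd0 m j
  have hdn : d n j = max (X n j - 2 * B * v j * p n) 0 := if_pos hn
  have h2 : v j ≤ ∑ i, v i := Finset.single_le_sum (fun i _ => hv0 i) (Finset.mem_univ j)
  have h3 : 2 * B * v j * p n ≤ 2 * B * (∑ i, v i) * p n := by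
    have := hp.nonneg n
    gcongr
  linarith [le_max_left (X n j - 2 * B * v j * p n) 0]

/-- The asymptotics of a nonnegative summable solution of `X = b + X * A` on the half line. -/
theorem tendsto_div_of_eq_add_conv [DecidableEq ι] (hp : IsSubexpSeq p)
    (hA : ∀ i j, IsJumpKernel p (fun m => A m i j) (C i j))
    (hS : ∀ i j, ∑' m, A m i j = S i j)
    (hsub : IsStrictlySubstochastic S) (hirr : S.IsIrreducible)
    (hX0 : ∀ n i, 0 ≤ X n i) (hXs : ∀ i, Summable fun n => X n i)
    (hb : ∀ j, Tendsto (fun n => b n j / p n) atTop (𝓝 (β j)))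
    (hX : ∀ n ≥ 1, ∀ j, X n j = b n j + ∑ i, ∑' k : ℕ, X k i * A (n - k) i j) (j : ι) :
    Tendsto (fun n => X n j / p n) atTop
      (𝓝 (((β + (fun i => ∑' n, X n i) ᵥ* C) ᵥ* (1 - S)⁻¹) j)) := by
  obtain ⟨B, hB⟩ := exists_eventually_le_mul hp hA hS hsub hirr hX0 hXs hb hX
  set y : ι → ℝ := (β + (fun i => ∑' n, X n i) ᵥ* C) ᵥ* (1 - S)⁻¹ with hy
  have hy1 : ∀ j, y j = β j + ∑ i, (∑' n, X n i) * C i j + ∑ i, y i * S i j :=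
    hsub.vecMul_inv_eq hirr _
  set u : ℕ → ι → ℝ := fun n j => |X n j / p n - y j| with hu
  -- The real `limsup` is informative only for bounded sequences; the a priori bound `O(p)` provides
  -- this.
  have hbdd : ∀ j, IsBoundedUnder (· ≤ ·) atTop fun n => u n j := by
    intro j
    refine ⟨B + |y j|, ?_⟩
    rw [eventually_map]
    filter_upwards [hB, hp.eventually_pos] with n hn hpn
    have h1 : X n j / p n ≤ B := (div_le_iff₀ hpn).2 (hn j)
    have h2 : 0 ≤ X n j / p n := div_nonneg (hX0 n j) hpn.le
    have h3 := abs_sub (X n j / p n) (y j)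
    rw [abs_of_nonneg h2] at h3
    simp only [hu]
    linarith
  have hcobdd : ∀ j, IsCoboundedUnder (· ≤ ·) atTop fun n => u n j := fun j =>
    IsBoundedUnder.isCoboundedUnder_le (isBoundedUnder_of ⟨0, fun n => abs_nonneg _⟩)
  set s : ι → ℝ := fun j => limsup (fun n => u n j) atTop with hs
  have hlt : ∀ j, ∀ δ > 0, ∀ᶠ n in atTop, u n j < s j + δ := fun j δ hδ =>
    eventually_lt_of_limsup_lt (lt_add_of_pos_right _ hδ) (hbdd j)
  have hs0 : ∀ j, 0 ≤ s j := by
    intro j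
    refine le_of_forall_pos_lt_add fun δ hδ => ?_
    obtain ⟨n, hn⟩ := (hlt j δ hδ).exists
    exact (abs_nonneg _).trans_lt hn
  -- Subtracting `p n` times the fixed-point equation for `y` leaves only the deviations of `X` from
  -- `p y`, carried through `S`.
  have hkey : ∀ j, ∀ δ > 0,
      s j ≤ ∑ i, s i * S i j + δ * (1 + ∑ i, S i j + Fintype.card ι) := by
    intro j δ hδ
    have hconv : ∀ᶠ n : ℕ in atTop, ∀ i, |∑' k : ℕ, X k i * A (n - k) i j -
        p n * (C i j * ∑' k, X k i + y i * S i j)| ≤ p n * ((s i + δ) * S i j + δ) := by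
      rw [eventually_all]
      intro i
      have h := (hA i j).eventually_abs_conv_sub_le hp (hXs i) (y := y i) (s := s i + δ)
        (add_nonneg (hs0 i) hδ.le) ?_ hδ
      · simpa only [hS i j] using h
      · filter_upwards [hlt i δ hδ, hp.eventually_pos] with n hn hpn
        have : X n i - y i * p n = (X n i / p n - y i) * p n := by field_simp
        rw [this, abs_mul, abs_of_pos hpn]
        exact mul_le_mul_of_nonneg_right hn.le hpn.le
    refine limsup_le_of_le (hcobdd j) ?_
    filter_upwards [hconv, hp.eventually_pos, eventually_ge_atTop 1,
      Metric.tendsto_nhds.1 (hb j) δ hδ] with n hn hpn hn1 hbn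
    rw [Real.dist_eq] at hbn
    have e1 : X n j - p n * y j = p n * (b n j / p n - β j) +
        ∑ i, (∑' k : ℕ, X k i * A (n - k) i j - p n * (C i j * ∑' k, X k i + y i * S i j)) := by
      rw [hX n hn1 j, hy1 j, Finset.sum_sub_distrib, ← Finset.mul_sum, Finset.sum_add_distrib,
        Finset.sum_congr rfl fun i _ => mul_comm (C i j) (∑' k, X k i)]
      field_simp
      ring
    have e2 : |X n j - p n * y j| ≤ p n * δ + ∑ i, p n * ((s i + δ) * S i j + δ) := by
      rw [e1]
      refine (abs_add_le _ _).trans (add_le_add ?_ ((Finset.abs_sum_le_sum_abs _ _).trans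
        (Finset.sum_le_sum fun i _ => hn i)))
      rw [abs_mul, abs_of_pos hpn]
      exact mul_le_mul_of_nonneg_left hbn.le hpn.le
    have e3 : u n j = |X n j - p n * y j| / p n := by
      simp only [hu]
      rw [← abs_of_pos hpn, ← abs_div, abs_of_pos hpn]
      congr 1
      field_simp
    rw [e3, div_le_iff₀ hpn]
    refine e2.trans (le_of_eq ?_)
    rw [← Finset.mul_sum, Finset.sum_add_distrib]
    simp only [add_mul, Finset.sum_add_distrib, ← Finset.mul_sum, Finset.sum_const,
      Finset.card_univ, nsmul_eq_mul]
    ring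
  have hsle : ∀ j, s j ≤ (s ᵥ* S) j := by
    intro j
    set c : ℝ := 1 + ∑ i, S i j + Fintype.card ι with hc
    have hc0 : 0 < c := by
      have := Finset.sum_nonneg fun i (_ : i ∈ Finset.univ) => hsub.nonneg i j
      positivity
    refine le_of_forall_pos_le_add fun η hη => ?_
    have := hkey j (η / c) (div_pos hη hc0)
    rwa [← hc, div_mul_cancel₀ _ hc0.ne'] at this
  have hs' := hsub.nonpos_of_le_vecMul hirr hsle j
  rw [Metric.tendsto_nhds]
  intro δ hδ
  filter_upwards [hlt j δ hδ] with n hn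
  rw [Real.dist_eq]
  exact hn.trans_le (by linarith)

end HalfLine

/-! ### Locally subexponential laws of span one -/

section Laws

variable (μ : Measure ℕ) [IsProbabilityMeasure μ]

theorem window_one (k : ℕ) : window 1 k = {k + 1} := by
  ext n
  have : ((n : ℕ∞) ≤ (k : ℕ∞) + 1) ↔ n ≤ k + 1 := by exact_mod_cast Iff.rfl
  simp only [window, Set.mem_ofPred_eq, this, Set.mem_singleton_iff]
  lia

theorem hasSum_real_singleton : HasSum (fun n => μ.real {n}) 1 := by
  have h := μ.toPMF.hasSum_coe_one
  have h' := ENNReal.hasSum_toReal (h.tsum_eq ▸ ENNReal.one_ne_top)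
  rw [← ENNReal.tsum_toReal_eq fun n => μ.toPMF.apply_ne_top n, h.tsum_eq, ENNReal.toReal_one] at h'
  exact h'

theorem conv_real_singleton (n : ℕ) :
    (μ.conv μ).real {n} = ∑ k ∈ Finset.range (n + 1), μ.real {k} * μ.real {n - k} := by
  have hset : (fun q : ℕ × ℕ => q.1 + q.2) ⁻¹' {n} =
      ⋃ k ∈ Finset.range (n + 1), ({k} : Set ℕ) ×ˢ ({n - k} : Set ℕ) := by
    ext ⟨a, b⟩
    simp only [Set.mem_preimage, Set.mem_singleton_iff, Set.mem_iUnion, Set.mem_prod,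
      Finset.mem_range, exists_prop]
    constructor
    · intro h
      exact ⟨a, by lia, rfl, by lia⟩
    · rintro ⟨k, hk, rfl, rfl⟩
      lia
  rw [Measure.conv, map_measureReal_apply (by fun_prop) (measurableSet_singleton n), hset,
    measureReal_biUnion_finset]
  · exact Finset.sum_congr rfl fun k _ => measureReal_prod_prod _ _
  · intro k _ l _ hkl
    refine Set.disjoint_left.2 ?_
    rintro ⟨a, b⟩ h h'
    exact hkl (h.1.symm.trans h'.1)
  · intro k _
    exact (measurableSet_singleton _).prod (measurableSet_singleton _)

variable {μ}

/-- Of the limit `2` of the convolution ratio, the first and the last `K + 1` terms each take `P(Y ≤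
K)`. The middle keeps `2 - 2 P(Y ≤ K)`, small for large `K`. -/
theorem IsLocallySubexponential.isSubexpSeq (h : IsLocallySubexponential μ 1) :
    IsSubexpSeq fun n => μ.real {n} := by
  obtain ⟨⟨hpos, hratio⟩, hconv⟩ := h
  simp only [window_one] at hpos hratio hconv
  have hlt : IsLongTailedSeq fun n => μ.real {n} :=
    { nonneg := fun n => measureReal_nonneg
      summable := (hasSum_real_singleton μ).summable
      eventually_pos := by
        obtain ⟨N, hN⟩ := eventually_atTop.1 hpos
        filter_upwards [eventually_gt_atTop N] with n hn
        obtain ⟨m, rfl⟩ : ∃ m, n = m + 1 := ⟨n - 1, by lia⟩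
        exact hN m (by lia)
      ratio := (tendsto_add_atTop_iff_nat 1).1 hratio }
  refine { hlt with middle := fun ε hε => ?_ }
  have hconv' : Tendsto (fun n => (∑ k ∈ Finset.range (n + 1), μ.real {k} * μ.real {n - k}) /
      μ.real {n}) atTop (𝓝 2) := by
    simp only [← conv_real_singleton]
    exact (tendsto_add_atTop_iff_nat 1).1 hconv
  have htot : Tendsto (fun K => ∑ k ∈ Finset.range (K + 1), μ.real {k}) atTop (𝓝 1) :=
    (hasSum_real_singleton μ).tendsto_sum_nat.comp (tendsto_add_atTop_nat 1)
  obtain ⟨K₀, hK₀⟩ := eventually_atTop.1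
    (htot.eventually_const_lt (show 1 - ε / 2 < 1 by linarith))
  refine ⟨K₀, fun K hK => ?_⟩
  have hhead : Tendsto (fun n => (∑ k ∈ Finset.range (K + 1), μ.real {k} * μ.real {n - k}) /
      μ.real {n}) atTop (𝓝 (∑ k ∈ Finset.range (K + 1), μ.real {k})) := by
    simp only [Finset.sum_div]
    refine tendsto_finsetSum _ fun k _ => ?_
    have := (hlt.tendsto_sub_div k).const_mul (μ.real {k})
    rw [mul_one] at this
    refine this.congr fun n => ?_
    rw [mul_div_assoc]
    congr 5
    lia
  have hlim := hconv'.sub (hhead.const_mul 2)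
  filter_upwards [hlim.eventually_lt_const (show _ < ε by linarith [hK₀ K hK]),
    hlt.eventually_pos, eventually_gt_atTop (2 * K + 1)] with n hn hpn hnK
  have hsplit : ∑ k ∈ Finset.range (n + 1), μ.real {k} * μ.real {n - k} =
      2 * ∑ k ∈ Finset.range (K + 1), μ.real {k} * μ.real {n - k} +
        ∑ k ∈ Finset.Ioo K (n - K), μ.real {k} * μ.real {n - k} := by
    have h1 : ∑ k ∈ Finset.Ico (n - K) (n + 1), μ.real {k} * μ.real {n - k} =
        ∑ k ∈ Finset.range (K + 1), μ.real {k} * μ.real {n - k} := by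
      refine Finset.sum_nbij' (fun k => n - k) (fun k => n - k) ?_ ?_ ?_ ?_ ?_
      · intro k hk; simp only [Finset.mem_Ico, Finset.mem_range] at *; lia
      · intro k hk; simp only [Finset.mem_Ico, Finset.mem_range] at *; lia
      · intro k hk; simp only [Finset.mem_Ico] at *; lia
      · intro k hk; simp only [Finset.mem_range] at *; lia
      · intro k hk
        simp only [Finset.mem_Ico] at hk
        rw [Nat.sub_sub_self (by lia), mul_comm]
    have h2 : Finset.Ioo K (n - K) = Finset.Ico (K + 1) (n - K) := by
      ext k
      simp only [Finset.mem_Ioo, Finset.mem_Ico]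
      lia
    rw [h2, two_mul]
    nth_rewrite 2 [← h1]
    simp only [Finset.range_eq_Ico]
    rw [← Finset.sum_Ico_consecutive _ (Nat.zero_le (K + 1)) (show K + 1 ≤ n + 1 by lia),
      ← Finset.sum_Ico_consecutive _ (show K + 1 ≤ n - K by lia) (show n - K ≤ n + 1 by lia)]
    ring
  rw [hsplit, ← mul_div_assoc, ← sub_div, add_sub_cancel_left, div_lt_iff₀ hpn] at hn
  exact hn.le

end Laws

/-! ### Stationary distributions of chains of GI/G/1 type -/

theorem IsStationaryDistribution.pos {S : Type*} {T : Matrix S S ℝ} {x : S → ℝ}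
    (hx : IsStationaryDistribution x T) (hT : T.IsIrreducible) (t : S) : 0 < x t := by
  obtain ⟨s, hs⟩ : ∃ s, 0 < x s := by
    by_contra! h
    have h0 : x = 0 := funext fun s => le_antisymm (h s) (hx.nonneg s)
    have := hx.total
    rw [h0] at this
    exact zero_ne_one (hasSum_zero.unique this)
  refine irreducible_induction hT (P := fun s => 0 < x s) (fun s t hst hs => ?_) hs t
  exact (mul_pos hs hst).trans_le
    (le_hasSum (hx.invariant t) s fun u _ => mul_nonneg (hx.nonneg u) (hT.nonneg u t))

namespace Blocks

variable {M₀ M : ℕ} {D : Blocks M₀ M}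

/-- The displacement `m` occurs in `T`, from level `(-m)⁺ + 1` to level `m⁺ + 1`. -/
theorem A_nonneg (hT : IsStochastic D.T) (m : ℤ) (i j : Fin M) : 0 ≤ D.A m i j := by
  have h := hT.nonneg (Sum.inr ((-m).toNat, i)) (Sum.inr (m.toNat, j))
  have e : (m.toNat : ℤ) - ((-m).toNat : ℤ) = m := by lia
  simpa only [T, e] using h

theorem Bup_nonneg (hT : IsStochastic D.T) (n : ℕ) (i : Fin M₀) (j : Fin M) :
    0 ≤ D.Bup (n + 1) i j :=
  hT.nonneg (Sum.inl i) (Sum.inr (n, j))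

/-- Any finitely many displacements fit into a single row of `T` started high enough, so their sum
is at most `1`. -/
theorem summable_A (hT : IsStochastic D.T) (i j : Fin M) : Summable fun m => D.A m i j := by
  refine summable_of_sum_le (c := 1) (fun m => A_nonneg hT m i j) fun F => ?_
  obtain ⟨k, hk⟩ : ∃ k : ℕ, ∀ m ∈ F, -(k : ℤ) ≤ m := by
    refine ⟨F.sup Int.natAbs, fun m hm => ?_⟩
    have : m.natAbs ≤ F.sup Int.natAbs := Finset.le_sup hm
    lia
  let f : ℤ → State M₀ M := fun m => Sum.inr ((m + k).toNat, j)
  have hinj : Set.InjOn f F := by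
    intro m hm m' hm' h
    simp only [f, Sum.inr.injEq, Prod.mk.injEq, and_true] at h
    have := hk m hm
    have := hk m' hm'
    lia
  have hsum := sum_le_hasSum (F.image f) (fun t _ => hT.nonneg (Sum.inr (k, i)) t)
    (hT.row_sum (Sum.inr (k, i)))
  rw [Finset.sum_image hinj] at hsum
  refine (Finset.sum_congr rfl fun m hm => ?_).trans_le hsum
  have e : ((m + k).toNat : ℤ) - k = m := by have := hk m hm; lia
  simp only [f, T, e]

/-- The sequence of levels, with a zero row in place of level `0`. -/
def levels (x : State M₀ M → ℝ) : ℕ → Fin M → ℝ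
  | 0 => 0
  | n + 1 => levelSucc x n

theorem summable_levelSucc {x : State M₀ M → ℝ} (hx : IsStationaryDistribution x D.T)
    (i : Fin M) : Summable fun n => levelSucc x n i :=
  hx.total.summable.comp_injective (i := fun n : ℕ => (Sum.inr (n, i) : State M₀ M))
    fun n m h => by simpa using h

theorem summable_levels {x : State M₀ M → ℝ} (hx : IsStationaryDistribution x D.T)
    (i : Fin M) : Summable fun n => levels x n i :=
  (summable_nat_add_iff 1).1 (summable_levelSucc hx i)

theorem tsum_levels {x : State M₀ M → ℝ} (hx : IsStationaryDistribution x D.T) (i : Fin M) :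
    ∑' n, levels x n i = tailZero x i := by
  rw [(summable_levels hx i).tsum_eq_zero_add]
  exact zero_add _

theorem levels_nonneg {x : State M₀ M → ℝ} (hx : IsStationaryDistribution x D.T) (n : ℕ)
    (i : Fin M) : 0 ≤ levels x n i := by
  cases n with
  | zero => exact le_rfl
  | succ n => exact hx.nonneg _

/-- The balance equations at the positive levels. -/
theorem levels_eq {x : State M₀ M → ℝ}
    (hx : IsStationaryDistribution x D.T) {n : ℕ} (hn : 1 ≤ n) (j : Fin M) :
    levels x n j = ∑ i, levelZero x i * D.Bup n i j +
      ∑ i, ∑' k : ℕ, levels x k i * D.A (n - k) i j := by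
  obtain ⟨n, rfl⟩ : ∃ m, n = m + 1 := ⟨n - 1, by lia⟩
  have hinv := hx.invariant (Sum.inr (n, j))
  have hs := hinv.summable
  have hl : Summable ((fun s => x s * D.T s (Sum.inr (n, j))) ∘ Sum.inl) :=
    hs.comp_injective Sum.inl_injective
  have hr : Summable ((fun s => x s * D.T s (Sum.inr (n, j))) ∘ Sum.inr) :=
    hs.comp_injective Sum.inr_injective
  have hri : ∀ i, Summable fun k : ℕ => levelSucc x k i * D.A ((n : ℤ) - k) i j := fun i =>
    hr.comp_injective (i := fun k : ℕ => (k, i)) fun k l h => by simpa using h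
  have h := hinv.unique (hl.hasSum.sum hr.hasSum)
  rw [tsum_fintype, hr.tsum_prod] at h
  -- The zero row at `k = 0` drops out, and shifting both levels by one preserves their difference.
  have e : ∀ i, ∑' k : ℕ, levels x k i * D.A ((n + 1 : ℕ) - k) i j =
      ∑' k : ℕ, levelSucc x k i * D.A ((n : ℤ) - k) i j := by
    intro i
    have e' : ∀ k : ℕ, levels x (k + 1) i * D.A ((n + 1 : ℕ) - (k + 1 : ℕ)) i j =
        levelSucc x k i * D.A ((n : ℤ) - k) i j := by
      intro k
      have : ((n + 1 : ℕ) : ℤ) - (k + 1 : ℕ) = n - k := by lia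
      rw [this]
      rfl
    rw [Summable.tsum_eq_zero_add]
    · simp only [e']
      simp [levels]
    · refine (summable_nat_add_iff 1).1 ?_
      simpa only [e'] using hri i
  simp only [e]
  rw [← Summable.tsum_finsetSum fun i _ => hri i]
  simp only [tsum_fintype] at h
  exact h

/-- The two alternatives for the left tail merge in `lower`: a radius above `1` yields some `r > 1`,
which eventually exceeds the ratios of `p`; monotonicity allows `r = 1`. -/
theorem isJumpKernel (hT : IsStochastic D.T) {p : ℕ → ℝ} (hp : IsSubexpSeq p)
    {C : Matrix (Fin M) (Fin M) ℝ}
    (hC : ∀ i j, Tendsto (fun k : ℕ => D.A k i j / p k) atTop (𝓝 (C i j)))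
    (hr : 1 < D.radiusAneg ∨ EventuallyNonincreasing p) (i j : Fin M) :
    IsJumpKernel p (fun m => D.A m i j) (C i j) where
  nonneg m := A_nonneg hT m i j
  summable := summable_A hT i j
  tendsto := hC i j
  lower := by
    rcases hr with hr | ⟨k₀, hk₀⟩
    · simp only [radiusAneg, lt_iSup_iff] at hr
      obtain ⟨r, hr, hr1⟩ := hr
      have hr1' : (1 : ℝ) < r := by exact_mod_cast hr1
      refine ⟨r, r.2, (summable_nat_add_iff 1).1 ?_, ?_⟩
      · simpa only [abs_of_nonneg (A_nonneg hT _ i j), Nat.cast_add, Nat.cast_one] using hr i j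
      · filter_upwards [hp.ratio.eventually_lt_const hr1', hp.eventually_pos] with n hn hpn
        exact ((div_lt_iff₀ hpn).1 hn).le
    · refine ⟨1, zero_le_one, ?_, ?_⟩
      · simp only [one_pow, one_mul]
        exact (summable_A hT i j).comp_injective (i := fun l : ℕ => -(l : ℤ))
          fun l l' h => by simpa using h
      · filter_upwards [eventually_ge_atTop k₀] with n hn
        simpa using hk₀ n hn

/-- Irreducibility makes `x` positive everywhere, so one positive entry of `C_A` or `C_B` suffices.
-/
theorem exists_forcing_pos (hirr : D.T.IsIrreducible)
    {x : State M₀ M → ℝ} (hx : IsStationaryDistribution x D.T)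
    {C_A : Matrix (Fin M) (Fin M) ℝ} {C_B : Matrix (Fin M₀) (Fin M) ℝ}
    (hA0 : ∀ i j, 0 ≤ C_A i j) (hB0 : ∀ i j, 0 ≤ C_B i j) (hC : C_A ≠ 0 ∨ C_B ≠ 0) :
    (∀ j, 0 ≤ (levelZero x ᵥ* C_B + tailZero x ᵥ* C_A) j) ∧
      ∃ j, 0 < (levelZero x ᵥ* C_B + tailZero x ᵥ* C_A) j := by
  have hpos := hx.pos hirr
  have hz : ∀ i, 0 < levelZero x i := fun i => hpos _
  have ht : ∀ i, 0 < tailZero x i := fun i =>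
    (summable_levelSucc hx i).tsum_pos (fun n => hx.nonneg _) 0 (hpos _)
  have hB : ∀ i j, 0 ≤ levelZero x i * C_B i j := fun i j => mul_nonneg (hz i).le (hB0 i j)
  have hA : ∀ i j, 0 ≤ tailZero x i * C_A i j := fun i j => mul_nonneg (ht i).le (hA0 i j)
  have hBs : ∀ j, 0 ≤ (levelZero x ᵥ* C_B) j := fun j =>
    Finset.sum_nonneg (s := Finset.univ) fun i _ => hB i j
  have hAs : ∀ j, 0 ≤ (tailZero x ᵥ* C_A) j := fun j =>
    Finset.sum_nonneg (s := Finset.univ) fun i _ => hA i j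
  refine ⟨fun j => add_nonneg (hBs j) (hAs j), ?_⟩
  rcases hC with hC | hC
  · obtain ⟨i, j, hij⟩ : ∃ i j, C_A i j ≠ 0 := by
      by_contra! h
      exact hC (Matrix.ext h)
    have h := mul_pos (ht i) (lt_of_le_of_ne (hA0 i j) hij.symm)
    exact ⟨j, add_pos_of_nonneg_of_pos (hBs j) (h.trans_le
      (Finset.single_le_sum (fun i _ => hA i j) (Finset.mem_univ i)))⟩
  · obtain ⟨i, j, hij⟩ : ∃ i j, C_B i j ≠ 0 := by
      by_contra! h
      exact hC (Matrix.ext h)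
    have h := mul_pos (hz i) (lt_of_le_of_ne (hB0 i j) hij.symm)
    exact ⟨j, add_pos_of_pos_of_nonneg (h.trans_le
      (Finset.single_le_sum (fun i _ => hB i j) (Finset.mem_univ i))) (hAs j)⟩

end Blocks

end GIG1

theorem theorem4p3 {M₀ M : ℕ} (D : GIG1.Blocks M₀ M)
    (hT_stoch : GIG1.IsStochastic D.T)
    (hT_irr : D.T.IsIrreducible)
    (hT_rec : GIG1.IsPositiveRecurrent D.T)
    (hA_irr : D.Asum.IsIrreducible)
    (hA_sub : GIG1.IsStrictlySubstochastic D.Asum)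
    (x : GIG1.State M₀ M → ℝ)
    (hx : GIG1.IsStationaryDistribution x D.T)
    {Ω : Type*} [MeasurableSpace Ω] (P : Measure Ω) [IsProbabilityMeasure P]
    (Y : Ω → ℕ) (hY : Measurable Y)
    (C_A : Matrix (Fin M) (Fin M) ℝ) (C_B : Matrix (Fin M₀) (Fin M) ℝ)
    (hC_A : ∀ i j, Tendsto (fun k : ℕ => D.A (k : ℤ) i j / P.real {ω | Y ω = k}) atTop
      (𝓝 (C_A i j)))
    (hC_B : ∀ i j, Tendsto (fun k : ℕ => D.Bup k i j / P.real {ω | Y ω = k}) atTop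
      (𝓝 (C_B i j)))
    (hC : C_A ≠ 0 ∨ C_B ≠ 0)
    (hYS : GIG1.IsLocallySubexponential (P.map Y) 1)
    (hr : 1 < D.radiusAneg ∨
      GIG1.EventuallyNonincreasing (fun k : ℕ => P.real {ω | Y ω = k})) :
    IsUnit (1 - D.Asum) ∧
      (∀ j, Tendsto
        (fun n : ℕ => GIG1.levelSucc x n j / P.real {ω | Y ω = n + 1}) atTop
        (𝓝 (((GIG1.levelZero x ᵥ* C_B + GIG1.tailZero x ᵥ* C_A) ᵥ* (1 - D.Asum)⁻¹) j))) ∧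
      ∀ j, 0 < ((GIG1.levelZero x ᵥ* C_B + GIG1.tailZero x ᵥ* C_A) ᵥ* (1 - D.Asum)⁻¹) j := by
  have : IsProbabilityMeasure (P.map Y) := Measure.isProbabilityMeasure_map hY.aemeasurable
  have hpY : (fun k : ℕ => (P.map Y).real {k}) = fun k : ℕ => P.real {ω | Y ω = k} :=
    funext fun k => map_measureReal_apply hY (measurableSet_singleton k)
  have hp := hYS.isSubexpSeq
  rw [hpY] at hp
  have hker := fun i j => GIG1.Blocks.isJumpKernel hT_stoch hp hC_A hr i j
  -- The shift avoids `Bup 0`, whose sign is unconstrained.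
  have hB0 : ∀ i j, 0 ≤ C_B i j := fun i j => ge_of_tendsto
    ((tendsto_add_atTop_iff_nat 1).2 (hC_B i j)) (Eventually.of_forall fun n =>
      div_nonneg (GIG1.Blocks.Bup_nonneg hT_stoch n i j) (hp.nonneg _))
  obtain ⟨hc0, i, hi⟩ := GIG1.Blocks.exists_forcing_pos hT_irr hx
    (fun i j => (hker i j).constant_nonneg hp) hB0 hC
  refine ⟨hA_sub.isUnit_one_sub hA_irr, fun j => ?_, hA_sub.vecMul_inv_pos hA_irr hc0 hi⟩
  have h := GIG1.tendsto_div_of_eq_add_conv hp hker (fun _ _ => rfl) hA_sub hA_irr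
    (GIG1.Blocks.levels_nonneg hx) (GIG1.Blocks.summable_levels hx)
    (b := fun n j => ∑ i, GIG1.levelZero x i * D.Bup n i j)
    (β := GIG1.levelZero x ᵥ* C_B) (fun j => by
      simp only [Finset.sum_div, mul_div_assoc]
      exact tendsto_finsetSum _ fun i _ => (hC_B i j).const_mul _)
    (fun n hn j => GIG1.Blocks.levels_eq hx hn j) j
  simp only [GIG1.Blocks.tsum_levels hx] at h
  exact (tendsto_add_atTop_iff_nat 1).2 h
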